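/- Let $E=(E^0,E^1,r,s)$ be an arbitrary directed graph, let $K$ be a field, and let $L=L_K(E)$ be the Leavitt path algebra of $E$ over $K$, that is, the (not necessarily unital) $K$-algebra generated by pairwise orthogonal idempotents $v$ ($v\in E^0$) and elements $e,e^*$ ($e\in E^1$) subject to the relations $s(e)e=e=er(e)$, $r(e)e^*=e^*=e^*s(e)$, $e^*e=r(e)$, $e^*f=0$ for $e\ne f$, and $v=\sum_{s(e)=v}ee^*$ for every vertex $v$ that emits a non-empty finite set of edges. An infinite path is a sequence $p=e_1e_2e_3\cdots$ of edges with $r(e_i)=s(e_{i+1})$ for all $i$. Two infinite paths are tail-equivalent if they become equal after deleting suitable finite initial segments; $[p]$ is the tail-equivalence class of $p$. The path $p$ is rational if it is tail-equivalent to $ccc\cdots$ for some closed path $c$ of positive length, and irrational otherwise. The Chen module $V_{[p]}$ is the left $L$-module that is the $K$-vector space with basis $[p]$, on which, for $q=f_1f_2\cdots\in[p]$, one has $v\cdot q=q$ if $s(f_1)=v$ and $0$ otherwise; $e\cdot q=eq$ if $r(e)=s(f_1)$ and $0$ otherwise; $e^*\cdot q=f_2f_3\cdots$ if $f_1=e$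 and $0$ otherwise. A vertex $v$ is a line point if no vertex that can be reached from $v$ by a path of length $\ge 0$ emits more than one edge or is the base of a cycle. Projectivity and finite presentation refer to the category of unitary left $L$-modules (those $M$ with $LM=M$); $M$ is finitely presented if there is an exact sequence $0\to N\to P\to M\to 0$ of unitary left $L$-modules with $P$ finitely generated projective and $N$ finitely generated. Theorem. Let $p$ be an irrational infinite path in $E$. Then the following are equivalent: (i) the left $L$-module $V_{[p]}$ is finitely presented; (ii) the left $L$-module $V_{[p]}$ is projective; (iii) the path $p$ contains a vertex which is a line point. -/

import Mathlib

universe r m k v e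

/-! ### Modules over rings that need not have an identity -/

/-- A left module over the (not necessarily unital) ring `R`: an abelian group `M` with an
additive and associative left action of `R`. -/
class NonUnitalModule (R : Type r) (M : Type m) [NonUnitalRing R] [AddCommGroup M] where
  /-- `act a x` is the product `a • x`. -/
  act : R →ₙ+* AddMonoid.End M

namespace NonUnitalModule

section

variable (R : Type r) [NonUnitalRing R]

/-- `M` is unitary, i.e. `R M = M`: every element of `M` is a finite sum of products `a • x`.
If `R` has an identity this says that the identity acts as the identity map. -/
def IsUnitary (M : Type m) [AddCommGroup M] [NonUnitalModule R M] : Prop :=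
  AddSubgroup.closure {y : M | ∃ (a : R) (x : M), y = act a x} = ⊤

/-- The additive map `f` is a homomorphism of `R`-modules. -/
def IsHom {M : Type*} {N : Type*} [AddCommGroup M] [NonUnitalModule R M]
    [AddCommGroup N] [NonUnitalModule R N] (f : M →+ N) : Prop :=
  ∀ (a : R) (x : M), f (act a x) = act a (f x)

/-- The subgroup `N` of `M` is an `R`-submodule. -/
def IsSubmodule {M : Type m} [AddCommGroup M] [NonUnitalModule R M] (N : AddSubgroup M) : Prop :=
  ∀ (a : R), ∀ x ∈ N, act a x ∈ N

/-- The submodule `N` of `M` is finitely generated: it is the smallest submodule of `M` that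
contains some finite set. -/
def IsFG {M : Type m} [AddCommGroup M] [NonUnitalModule R M] (N : AddSubgroup M) : Prop :=
  IsSubmodule R N ∧ ∃ S : Finset M, (S : Set M) ⊆ N ∧
    ∀ N' : AddSubgroup M, IsSubmodule R N' → (S : Set M) ⊆ N' → N ≤ N'

/-- `M` is a projective object of the category of unitary left `R`-modules: homomorphisms
from `M` lift along surjective homomorphisms of unitary modules. (The universe of the test
modules contains the direct sums of copies of `R` indexed by `M`.) -/
def IsProjective (M : Type m) [AddCommGroup M] [NonUnitalModule R M] : Prop :=
  IsUnitary R M ∧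
    ∀ (X Y : Type (max r m)) [AddCommGroup X] [NonUnitalModule R X]
      [AddCommGroup Y] [NonUnitalModule R Y],
      IsUnitary R X → IsUnitary R Y →
      ∀ (g : X →+ Y) (f : M →+ Y), IsHom R g → IsHom R f → Function.Surjective g →
        ∃ h : M →+ X, IsHom R h ∧ g.comp h = f

/-- `M` is finitely presented in the category of unitary left `R`-modules: there is an exact
sequence `0 → N → P → M → 0` with `P` finitely generated projective and `N` finitely generated.
(If `R` has no identity, `R` itself need not be finitely generated, so that the free modules of
the unital theory are replaced by finitely generated projective ones.) -/
def IsFinitelyPresented (M : Type m) [AddCommGroup M] [NonUnitalModule R M] : Prop :=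
  IsUnitary R M ∧
    ∃ (P : Type (max r m)) (_ : AddCommGroup P) (_ : NonUnitalModule R P) (π : P →+ M),
      IsProjective R P ∧ IsFG R (⊤ : AddSubgroup P) ∧
      IsHom R π ∧ Function.Surjective π ∧ IsFG R π.ker

end

end NonUnitalModule

/-! ### Directed graphs and paths -/

/-- A directed graph `(E⁰, E¹, r, s)` with set of vertices `V` and set of edges `E`. -/
structure DirectedGraph (V : Type v) (E : Type e) where
  /-- the range (end point) of an edge -/
  r : E → V
  /-- the source (initial point) of an edge -/
  s : E → V

namespace DirectedGraph

variable {V : Type v} {E : Type e} (G : DirectedGraph V E)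

/-- `u ≥ w`: there is a path (possibly of length `0`) from `u` to `w`. -/
def Reaches (u w : V) : Prop :=
  Relation.ReflTransGen (fun a b => ∃ x : E, G.s x = a ∧ G.r x = b) u w

/-- The list `c` of edges is a closed path (of positive length) based at `w`. -/
def IsClosedPathAt (c : List E) (w : V) : Prop :=
  c.IsChain (fun x y => G.r x = G.s y) ∧
    c.head?.map G.s = some w ∧ c.getLast?.map G.r = some w

/-- The list `c` of edges is a cycle based at `w`: a closed path that does not pass through any
of its vertices twice. -/
def IsCycleAt (c : List E) (w : V) : Prop :=
  G.IsClosedPathAt c w ∧ (c.map G.s).Nodup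

/-- `w` is a bifurcation vertex: it emits more than one edge. -/
def IsBifurcation (w : V) : Prop :=
  ∃ x y : E, x ≠ y ∧ G.s x = w ∧ G.s y = w

/-- `u` is a line point: no vertex of the tree `{w | u ≥ w}` of `u` is a bifurcation vertex or
the base of a cycle. -/
def IsLinePoint (u : V) : Prop :=
  ∀ w, G.Reaches u w → ¬ G.IsBifurcation w ∧ ¬ ∃ c : List E, G.IsCycleAt c w

/-- An infinite path: `edge 0, edge 1, edge 2, …` are its consecutive edges. -/
@[ext]
structure InfinitePath where
  /-- the edges of the path -/
  edge : ℕ → E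
  range_eq_source : ∀ n, G.r (edge n) = G.s (edge (n + 1))

namespace InfinitePath

variable {G}

/-- `n ↦ p.vertex n` enumerates the vertices on the path `p`. -/
def vertex (p : G.InfinitePath) (n : ℕ) : V := G.s (p.edge n)

/-- Removal of the first edge. -/
def tail (p : G.InfinitePath) : G.InfinitePath where
  edge n := p.edge (n + 1)
  range_eq_source n := p.range_eq_source (n + 1)

/-- The path `x q`, for an edge `x` that ends where `q` starts. -/
def cons (x : E) (q : G.InfinitePath) (h : G.r x = q.vertex 0) : G.InfinitePath where
  edge n := Nat.casesOn n x q.edge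
  range_eq_source n := by
    cases n with
    | zero => exact h
    | succ n => exact q.range_eq_source n

/-- Tail-equivalence: `τ^{>a}(p) = τ^{>b}(q)` for some `a`, `b`. -/
def TailEquiv (p q : G.InfinitePath) : Prop :=
  ∃ a b : ℕ, ∀ n, p.edge (a + n) = q.edge (b + n)

/-- `p` is rational: tail-equivalent to `q = c c c ⋯` for some closed path `c`. -/
def IsRational (p : G.InfinitePath) : Prop :=
  ∃ (c : List E) (w : V) (q : G.InfinitePath), G.IsClosedPathAt c w ∧
    (∀ n, getElem? c (n % c.length) = some (q.edge n)) ∧ p.TailEquiv q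

/-- `p` is irrational. -/
def IsIrrational (p : G.InfinitePath) : Prop := ¬ p.IsRational

theorem TailEquiv.tail {p q : G.InfinitePath} (h : p.TailEquiv q) : p.TailEquiv q.tail := by
  obtain ⟨a, b, h⟩ := h
  refine ⟨a + 1, b, fun n => ?_⟩
  have := h (n + 1)
  simpa [InfinitePath.tail, Nat.add_assoc, Nat.add_comm, Nat.add_left_comm] using this

theorem TailEquiv.cons {p q : G.InfinitePath} (h : p.TailEquiv q) (x : E)
    (hx : G.r x = q.vertex 0) : p.TailEquiv (q.cons x hx) := by
  obtain ⟨a, b, h⟩ := h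
  refine ⟨a, b + 1, fun n => ?_⟩
  have e : b + 1 + n = b + n + 1 := by omega
  rw [h n, e]
  rfl

/-- The tail-equivalence class `[p]`. -/
abbrev TailClass (p : G.InfinitePath) : Type e := {q : G.InfinitePath // p.TailEquiv q}

end InfinitePath

end DirectedGraph

/-! ### Leavitt path algebras -/

/-- The generators `v`, `x`, `x*` of a Leavitt path algebra. -/
inductive LeavittGen (V : Type v) (E : Type e) : Type (max v e)
  | vertex (w : V)
  | edge (x : E)
  | ghost (x : E)

/-- The images `g` of the generators in the ring `A` satisfy the defining relations of the
Leavitt path algebra of `G`. -/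
structure IsLeavittFamily {V : Type v} {E : Type e} (G : DirectedGraph V E) {A : Type*}
    [NonUnitalRing A] (g : LeavittGen V E → A) : Prop where
  idem (w : V) : g (.vertex w) * g (.vertex w) = g (.vertex w)
  orth (w w' : V) : w ≠ w' → g (.vertex w) * g (.vertex w') = 0
  source_edge (x : E) : g (.vertex (G.s x)) * g (.edge x) = g (.edge x)
  edge_range (x : E) : g (.edge x) * g (.vertex (G.r x)) = g (.edge x)
  range_ghost (x : E) : g (.vertex (G.r x)) * g (.ghost x) = g (.ghost x)
  ghost_source (x : E) : g (.ghost x) * g (.vertex (G.s x)) = g (.ghost x)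
  ck1 (x : E) : g (.ghost x) * g (.edge x) = g (.vertex (G.r x))
  ck1' (x y : E) : x ≠ y → g (.ghost x) * g (.edge y) = 0
  /-- For a regular vertex `w`, the non-empty finite set `S` consists of the edges emitted
  by `w`. -/
  ck2 (w : V) (S : Finset E) : S.Nonempty → (∀ x, x ∈ S ↔ G.s x = w) →
    g (.vertex w) = ∑ x ∈ S, g (.edge x) * g (.ghost x)

section Leavitt

open LeavittGen

variable (K : Type k) [Field K] {V : Type v} {E : Type e} (G : DirectedGraph V E)

/-- The defining relations of the Leavitt path algebra, in the free unital algebra. -/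
inductive LeavittRel : FreeAlgebra K (LeavittGen V E) → FreeAlgebra K (LeavittGen V E) → Prop
  | idem (w : V) : LeavittRel
      (FreeAlgebra.ι K (vertex w) * FreeAlgebra.ι K (vertex w)) (FreeAlgebra.ι K (vertex w))
  | orth (w w' : V) : w ≠ w' → LeavittRel
      (FreeAlgebra.ι K (vertex w) * FreeAlgebra.ι K (vertex w')) 0
  | source_edge (x : E) : LeavittRel
      (FreeAlgebra.ι K (vertex (G.s x)) * FreeAlgebra.ι K (edge x)) (FreeAlgebra.ι K (edge x))
  | edge_range (x : E) : LeavittRel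
      (FreeAlgebra.ι K (edge x) * FreeAlgebra.ι K (vertex (G.r x))) (FreeAlgebra.ι K (edge x))
  | range_ghost (x : E) : LeavittRel
      (FreeAlgebra.ι K (vertex (G.r x)) * FreeAlgebra.ι K (ghost x)) (FreeAlgebra.ι K (ghost x))
  | ghost_source (x : E) : LeavittRel
      (FreeAlgebra.ι K (ghost x) * FreeAlgebra.ι K (vertex (G.s x))) (FreeAlgebra.ι K (ghost x))
  | ck1 (x : E) : LeavittRel
      (FreeAlgebra.ι K (ghost x) * FreeAlgebra.ι K (edge x)) (FreeAlgebra.ι K (vertex (G.r x)))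
  | ck1' (x y : E) : x ≠ y → LeavittRel
      (FreeAlgebra.ι K (ghost x) * FreeAlgebra.ι K (edge y)) 0
  | ck2 (w : V) (S : Finset E) : S.Nonempty → (∀ x, x ∈ S ↔ G.s x = w) → LeavittRel
      (FreeAlgebra.ι K (vertex w))
      (∑ x ∈ S, FreeAlgebra.ι K (edge x) * FreeAlgebra.ι K (ghost x))

/-- The Leavitt path algebra with an identity adjoined: the unital algebra presented by the
generators and relations of the Leavitt path algebra. -/
abbrev UnitizedLeavitt : Type (max k v e) := RingQuot (LeavittRel K G)

/-- The image of a generator. -/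
noncomputable def UnitizedLeavitt.gen (g : LeavittGen V E) : UnitizedLeavitt K G :=
  RingQuot.mkAlgHom K (LeavittRel K G) (FreeAlgebra.ι K g)

/-- The Leavitt path algebra `L_K(E)`, a `K`-algebra in general without identity: the
non-unital subalgebra generated by the vertices, edges and ghost edges. It has the universal
property of the `K`-algebra with these generators and the defining relations, see
`LeavittPathAlgebra.existsUnique_lift` below. -/
def LeavittPathAlgebra : Type (max k v e) :=
  NonUnitalAlgebra.adjoin K (Set.range (UnitizedLeavitt.gen K G))

noncomputable instance : NonUnitalRing (LeavittPathAlgebra K G) :=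
  inferInstanceAs
    (NonUnitalRing (NonUnitalAlgebra.adjoin K (Set.range (UnitizedLeavitt.gen K G))))

noncomputable instance : Module K (LeavittPathAlgebra K G) :=
  inferInstanceAs
    (Module K (NonUnitalAlgebra.adjoin K (Set.range (UnitizedLeavitt.gen K G))))

instance : IsScalarTower K (LeavittPathAlgebra K G) (LeavittPathAlgebra K G) :=
  inferInstanceAs (IsScalarTower K
    (NonUnitalAlgebra.adjoin K (Set.range (UnitizedLeavitt.gen K G)))
    (NonUnitalAlgebra.adjoin K (Set.range (UnitizedLeavitt.gen K G))))

instance : SMulCommClass K (LeavittPathAlgebra K G) (LeavittPathAlgebra K G) :=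
  inferInstanceAs (SMulCommClass K
    (NonUnitalAlgebra.adjoin K (Set.range (UnitizedLeavitt.gen K G)))
    (NonUnitalAlgebra.adjoin K (Set.range (UnitizedLeavitt.gen K G))))

/-- The inclusion into the algebra with an identity adjoined. -/
noncomputable def LeavittPathAlgebra.incl : LeavittPathAlgebra K G →ₙₐ[K] UnitizedLeavitt K G :=
  NonUnitalSubalgebraClass.subtype
    (NonUnitalAlgebra.adjoin K (Set.range (UnitizedLeavitt.gen K G)))

variable {K G}

/-- The homomorphism to a unital algebra defined by a family that satisfies the relations. -/
noncomputable def UnitizedLeavitt.lift {A : Type*} [Ring A] [Algebra K A]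
    {g : LeavittGen V E → A} (hg : IsLeavittFamily G g) : UnitizedLeavitt K G →ₐ[K] A :=
  RingQuot.liftAlgHom K ⟨FreeAlgebra.lift K g, by
    intro a b h
    induction h with
    | idem w => simpa using hg.idem w
    | orth w w' h => simpa using hg.orth w w' h
    | source_edge x => simpa using hg.source_edge x
    | edge_range x => simpa using hg.edge_range x
    | range_ghost x => simpa using hg.range_ghost x
    | ghost_source x => simpa using hg.ghost_source x
    | ck1 x => simpa using hg.ck1 x
    | ck1' x y h => simpa using hg.ck1' x y h
    | ck2 w S h h' => simpa using hg.ck2 w S h h'⟩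

theorem UnitizedLeavitt.lift_gen {A : Type*} [Ring A] [Algebra K A]
    {g : LeavittGen V E → A} (hg : IsLeavittFamily G g) (x : LeavittGen V E) :
    UnitizedLeavitt.lift (K := K) hg (UnitizedLeavitt.gen K G x) = g x := by
  simp [UnitizedLeavitt.lift, UnitizedLeavitt.gen]

theorem UnitizedLeavitt.isLeavittFamily_gen :
    IsLeavittFamily G (UnitizedLeavitt.gen K G) := by
  have key : ∀ {a b}, LeavittRel K G a b →
      RingQuot.mkAlgHom K (LeavittRel K G) a = RingQuot.mkAlgHom K (LeavittRel K G) b :=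
    fun h => RingQuot.mkAlgHom_rel K h
  constructor
  · intro w; simpa [gen] using key (.idem w)
  · intro w w' h; simpa [gen] using key (.orth w w' h)
  · intro x; simpa [gen] using key (.source_edge x)
  · intro x; simpa [gen] using key (.edge_range x)
  · intro x; simpa [gen] using key (.range_ghost x)
  · intro x; simpa [gen] using key (.ghost_source x)
  · intro x; simpa [gen] using key (.ck1 x)
  · intro x y h; simpa [gen] using key (.ck1' x y h)
  · intro w S h h'; simpa [gen] using key (.ck2 w S h h')

namespace LeavittPathAlgebra

theorem incl_injective : Function.Injective (incl K G) := Subtype.val_injective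

/-- The generators of the Leavitt path algebra. -/
noncomputable def gen (g : LeavittGen V E) : LeavittPathAlgebra K G :=
  ⟨UnitizedLeavitt.gen K G g, NonUnitalAlgebra.subset_adjoin K ⟨g, rfl⟩⟩

theorem incl_gen (g : LeavittGen V E) : incl K G (gen g) = UnitizedLeavitt.gen K G g := rfl

theorem isLeavittFamily_gen : IsLeavittFamily G (gen : LeavittGen V E → LeavittPathAlgebra K G) := by
  have h := UnitizedLeavitt.isLeavittFamily_gen (K := K) (G := G)
  constructor
  · intro w; apply incl_injective; simpa [incl_gen] using h.idem w
  · intro w w' hw; apply incl_injective; simpa [incl_gen] using h.orth w w' hw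
  · intro x; apply incl_injective; simpa [incl_gen] using h.source_edge x
  · intro x; apply incl_injective; simpa [incl_gen] using h.edge_range x
  · intro x; apply incl_injective; simpa [incl_gen] using h.range_ghost x
  · intro x; apply incl_injective; simpa [incl_gen] using h.ghost_source x
  · intro x; apply incl_injective; simpa [incl_gen] using h.ck1 x
  · intro x y hx; apply incl_injective; simpa [incl_gen] using h.ck1' x y hx
  · intro w S h1 h2; apply incl_injective; simpa [incl_gen] using h.ck2 w S h1 h2

/-- Induction: the vertices, edges and ghost edges generate the Leavitt path algebra. -/
theorem gen_induction {P : LeavittPathAlgebra K G → Prop} (hgen : ∀ g, P (gen g))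
    (hadd : ∀ a b, P a → P b → P (a + b)) (hzero : P 0) (hmul : ∀ a b, P a → P b → P (a * b))
    (hsmul : ∀ (c : K) a, P a → P (c • a)) (a : LeavittPathAlgebra K G) : P a := by
  obtain ⟨a, ha⟩ := a
  induction ha using NonUnitalAlgebra.adjoin_induction with
  | mem x hx => obtain ⟨y, rfl⟩ := hx; exact hgen y
  | add x y hx hy h1 h2 => exact hadd _ _ h1 h2
  | zero => exact hzero
  | mul x y hx hy h1 h2 => exact hmul _ _ h1 h2
  | smul c x hx h1 => exact hsmul c _ h1

/-- The universal property of the Leavitt path algebra among all (not necessarily unital)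
`K`-algebras. -/
theorem existsUnique_lift {A : Type*} [NonUnitalRing A] [Module K A] [IsScalarTower K A A]
    [SMulCommClass K A A] {g : LeavittGen V E → A} (hg : IsLeavittFamily G g) :
    ∃! φ : LeavittPathAlgebra K G →ₙₐ[K] A, ∀ x, φ (gen x) = g x := by
  have hg' : IsLeavittFamily G (fun x => (g x : Unitization K A)) := by
    constructor
    · intro w; rw [← Unitization.inr_mul, hg.idem]
    · intro w w' h; rw [← Unitization.inr_mul, hg.orth w w' h, Unitization.inr_zero]
    · intro x; rw [← Unitization.inr_mul, hg.source_edge]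
    · intro x; rw [← Unitization.inr_mul, hg.edge_range]
    · intro x; rw [← Unitization.inr_mul, hg.range_ghost]
    · intro x; rw [← Unitization.inr_mul, hg.ghost_source]
    · intro x; rw [← Unitization.inr_mul, hg.ck1]
    · intro x y h; rw [← Unitization.inr_mul, hg.ck1' x y h, Unitization.inr_zero]
    · intro w S h h'
      have := congrArg (Unitization.inrNonUnitalAlgHom K A) (hg.ck2 w S h h')
      simpa [map_sum, map_mul] using this
  let ψ : LeavittPathAlgebra K G →ₙₐ[K] Unitization K A :=
    ((UnitizedLeavitt.lift (K := K) hg' : UnitizedLeavitt K G →ₐ[K] Unitization K A) :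
      UnitizedLeavitt K G →ₙₐ[K] Unitization K A).comp (incl K G)
  have hψ : ∀ x, ψ (gen x) = (g x : Unitization K A) := fun x =>
    UnitizedLeavitt.lift_gen (K := K) hg' x
  have hfst : ∀ a, (ψ a).fst = 0 := by
    intro a
    induction a using gen_induction with
    | hgen x => simp [hψ]
    | hadd a b h1 h2 => simp [h1, h2]
    | hzero => simp
    | hmul a b h1 h2 => simp [h1]
    | hsmul c a h1 => simp [h1]
  refine ⟨{ toFun := fun a => (ψ a).snd, map_smul' := ?_, map_zero' := ?_, map_add' := ?_,
            map_mul' := ?_ }, ?_, ?_⟩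
  · intro c a; simp
  · simp
  · intro a b; simp
  · intro a b; simp [hfst]
  · intro x
    change (ψ (gen x)).snd = g x
    rw [hψ]; simp
  · intro φ hφ
    apply NonUnitalAlgHom.ext
    intro a
    change φ a = (ψ a).snd
    induction a using gen_induction with
    | hgen x => simp [hψ, hφ]
    | hadd a b h1 h2 => simp [h1, h2]
    | hzero => simp
    | hmul a b h1 h2 => simp [h1, h2, hfst]
    | hsmul c a h1 => simp [h1]

end LeavittPathAlgebra

end Leavitt

/-! ### Chen modules -/

section Chen

open DirectedGraph InfinitePath

variable (K : Type k) [Field K] {V : Type v} {E : Type e} {G : DirectedGraph V E}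

/-- The `K`-vector space `V_[p]` with the class `[p]` as a basis. -/
def ChenModule (p : G.InfinitePath) : Type (max k e) := p.TailClass →₀ K

namespace ChenModule

variable (p : G.InfinitePath)

noncomputable instance : AddCommGroup (ChenModule K p) :=
  inferInstanceAs (AddCommGroup (p.TailClass →₀ K))

noncomputable instance : Module K (ChenModule K p) :=
  inferInstanceAs (Module K (p.TailClass →₀ K))

variable {p}

/-- The basis vector `q`. -/
noncomputable def basis (q : p.TailClass) : ChenModule K p := Finsupp.single q 1

open Classical in
/-- The action of the generators on the basis: `w q = q` if `q` starts at `w`;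
`x q` is the path `xq` if `q` starts at `r x`; `x* q` is `q` without its first edge if that edge
is `x`; and all other products vanish. -/
noncomputable def genOnBasis (g : LeavittGen V E) (q : p.TailClass) : ChenModule K p :=
  match g with
  | .vertex w => if q.1.vertex 0 = w then basis K q else 0
  | .edge x => if h : G.r x = q.1.vertex 0 then basis K ⟨q.1.cons x h, q.2.cons x h⟩ else 0
  | .ghost x => if q.1.edge 0 = x then basis K ⟨q.1.tail, q.2.tail⟩ else 0

variable (p) in
/-- The linear operator by which a generator acts. -/
noncomputable def genAct (g : LeavittGen V E) : Module.End K (ChenModule K p) :=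
  Finsupp.linearCombination K (genOnBasis K g)

theorem genAct_basis (g : LeavittGen V E) (q : p.TailClass) :
    genAct K p g (basis K q) = genOnBasis K g q := by
  unfold genAct basis
  exact (Finsupp.linearCombination_single K (1 : K) q).trans (one_smul _ _)

theorem end_ext {f g : Module.End K (ChenModule K p)}
    (h : ∀ q, f (basis K q) = g (basis K q)) : f = g :=
  Finsupp.lhom_ext' fun q => LinearMap.ext_ring (h q)

variable (p) in
theorem isLeavittFamily_genAct : IsLeavittFamily G (genAct K p) := by
  classical
  have tail_cons : ∀ (x : E) (q : G.InfinitePath) (h : G.r x = q.vertex 0),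
      (q.cons x h).tail = q := fun x q h => rfl
  have cons_tail : ∀ (q : G.InfinitePath) (h : G.r (q.edge 0) = q.tail.vertex 0),
      q.tail.cons (q.edge 0) h = q := by
    intro q h
    ext n
    cases n <;> rfl
  have hcons : ∀ (x : E) (q : G.InfinitePath) (h : G.r x = q.vertex 0),
      (q.cons x h).vertex 0 = G.s x := fun x q h => rfl
  have hcons' : ∀ (x : E) (q : G.InfinitePath) (h : G.r x = q.vertex 0),
      (q.cons x h).edge 0 = x := fun x q h => rfl
  have htail : ∀ (q : G.InfinitePath), G.r (q.edge 0) = q.tail.vertex 0 :=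
    fun q => q.range_eq_source 0
  constructor
  · intro w
    refine end_ext K fun q => ?_
    simp only [Module.End.mul_apply, genAct_basis, genOnBasis]
    split_ifs with h <;> simp [genAct_basis, genOnBasis, h]
  · intro w w' hw
    refine end_ext K fun q => ?_
    simp only [Module.End.mul_apply, genAct_basis, genOnBasis]
    split_ifs with h
    · subst h; simp [genAct_basis, genOnBasis, hw.symm]
    · simp
  · intro x
    refine end_ext K fun q => ?_
    simp only [Module.End.mul_apply, genAct_basis, genOnBasis]
    split_ifs with h <;> simp [genAct_basis, genOnBasis, hcons]
  · intro x
    refine end_ext K fun q => ?_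
    simp only [Module.End.mul_apply, genAct_basis, genOnBasis]
    by_cases h : G.r x = q.1.vertex 0
    · simp [genAct_basis, genOnBasis, h]
    · simp [h, Ne.symm h]
  · intro x
    refine end_ext K fun q => ?_
    simp only [Module.End.mul_apply, genAct_basis, genOnBasis]
    split_ifs with h
    · subst h; simp [genAct_basis, genOnBasis, htail]
    · simp
  · intro x
    refine end_ext K fun q => ?_
    simp only [Module.End.mul_apply, genAct_basis, genOnBasis]
    by_cases h : q.1.edge 0 = x
    · subst h; simp [genAct_basis, genOnBasis, InfinitePath.vertex]
    · split_ifs <;> simp [genAct_basis, genOnBasis, h]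
  · intro x
    refine end_ext K fun q => ?_
    simp only [Module.End.mul_apply, genAct_basis, genOnBasis]
    by_cases h : G.r x = q.1.vertex 0
    · simp [genAct_basis, genOnBasis, h, hcons', tail_cons]
    · simp [h, Ne.symm h]
  · intro x y hxy
    refine end_ext K fun q => ?_
    simp only [Module.End.mul_apply, genAct_basis, genOnBasis]
    split_ifs with h <;> simp [genAct_basis, genOnBasis, hcons', hxy.symm]
  · intro w S _ hS
    refine end_ext K fun q => ?_
    have hterm : ∀ x, (genAct K p (.edge x) * genAct K p (.ghost x)) (basis K q) =
        if q.1.edge 0 = x then basis K q else 0 := by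
      intro x
      simp only [Module.End.mul_apply, genAct_basis, genOnBasis]
      split_ifs with h
      · subst h; simp [genAct_basis, genOnBasis, htail, cons_tail]
      · simp
    rw [LinearMap.sum_apply, Finset.sum_congr rfl fun x _ => hterm x, Finset.sum_ite_eq,
      genAct_basis]
    simp only [genOnBasis, hS, InfinitePath.vertex]
    congr

/-- `V_[p]` as a left module over the Leavitt path algebra. -/
noncomputable instance (p : G.InfinitePath) :
    NonUnitalModule (LeavittPathAlgebra K G) (ChenModule K p) where
  act :=
    { toFun := fun a =>
        (UnitizedLeavitt.lift (isLeavittFamily_genAct K p)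
          (LeavittPathAlgebra.incl K G a)).toAddMonoidHom
      map_mul' := fun a b => AddMonoidHom.ext fun x => by simp; rfl
      map_zero' := AddMonoidHom.ext fun x => by simp; rfl
      map_add' := fun a b => AddMonoidHom.ext fun x => by simp; rfl }

/-- The generators act as prescribed. -/
theorem act_gen_basis (g : LeavittGen V E) (q : p.TailClass) :
    NonUnitalModule.act (LeavittPathAlgebra.gen g : LeavittPathAlgebra K G) (basis K q) =
      genOnBasis K g q := by
  change UnitizedLeavitt.lift (isLeavittFamily_genAct K p) (UnitizedLeavitt.gen K G g)
    (basis K q) = _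
  rw [UnitizedLeavitt.lift_gen, genAct_basis]

end ChenModule

end Chen

-- Let `q` generate `M`. Then `M` is projective iff `a ↦ a q` splits, i.e. iff some `f` satisfies `f
-- q = q` and `Ann(q) f = 0` (`IsSplitGenerator`); the splitting is `a q ↦ a f`.
--
-- For irrational `p` put `uₙ = βₙ βₙ*`, where `βₙ` is the path of the first `n` edges of `p`. For
-- each `q ∈ [p]` and all large `n` one can write `q = α p'`, `p = βₙ p'`; irrationality makes `α`
-- unique, and `σₙ(q) = α βₙ*` satisfies `σₙ(q) p = q`. For each fixed `a`, `a uₙ = σₙ(a p)` once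
-- `n` is large (`eventually_mul_segIdem`). As `uₙ p = p`, the annihilator of `p` is the union of
-- the left annihilators of the `uₙ`.
--
-- If `p` meets a line point, `uₙ` is eventually constant and serves as `f`. Conversely, an `f`
-- forces `uₙ₊₁ uₙ = uₙ` for large `n`. A second edge at the `n`-th vertex would contradict this,
-- because vertices are nonzero in `L` (`gen_vertex_ne_zero`); so `p` eventually has no
-- bifurcations, and by irrationality it then runs through line points.
--
-- In a finite presentation the kernel has finitely many generators, all dealt with by a single
-- `uₙ`; this again produces an `f`.

universe w

/-! ### Cyclic projective modules over rings without identity -/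

namespace NonUnitalModule

section

variable {R : Type r} [NonUnitalRing R]

/-- The left regular module. -/
instance regular : NonUnitalModule R R where
  act :=
    { toFun := AddMonoidHom.mulLeft
      map_mul' := fun a b => AddMonoidHom.ext fun x => mul_assoc a b x
      map_zero' := AddMonoidHom.ext fun x => zero_mul x
      map_add' := fun a b => AddMonoidHom.ext fun x => add_mul a b x }

theorem act_regular (a b : R) : act a b = a * b := rfl

theorem mul_act {M : Type m} [AddCommGroup M] [NonUnitalModule R M] (a b : R) (x : M) :
    act (a * b) x = act a (act b x) := by
  rw [map_mul]; rfl

theorem add_act {M : Type m} [AddCommGroup M] [NonUnitalModule R M] (a b : R) (x : M) :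
    act (a + b) x = act a x + act b x := by
  rw [map_add]; rfl

theorem zero_act {M : Type m} [AddCommGroup M] [NonUnitalModule R M] (x : M) :
    act (0 : R) x = 0 := by
  rw [map_zero]; rfl

theorem sub_act {M : Type m} [AddCommGroup M] [NonUnitalModule R M] (a b : R) (x : M) :
    act (a - b) x = act a x - act b x := by
  rw [eq_sub_iff_add_eq, ← add_act, sub_add_cancel]

/-- The canonical map to a copy in a larger universe. -/
def upHom (M : Type m) [AddCommGroup M] : M →+ ULift.{w} M where
  toFun := ULift.up
  map_zero' := rfl
  map_add' _ _ := rfl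

/-- The canonical map from a copy in a larger universe. -/
def downHom (M : Type m) [AddCommGroup M] : ULift.{w} M →+ M where
  toFun := ULift.down
  map_zero' := rfl
  map_add' _ _ := rfl

/-- A module in a larger universe. -/
instance uliftModule {M : Type m} [AddCommGroup M] [NonUnitalModule R M] :
    NonUnitalModule R (ULift.{w} M) where
  act :=
    { toFun := fun a =>
        (upHom M).comp ((act a : AddMonoid.End M).comp (downHom M))
      map_mul' := fun a b => AddMonoidHom.ext fun x => congrArg ULift.up (mul_act a b x.down)
      map_zero' := AddMonoidHom.ext fun x => congrArg ULift.up (zero_act x.down)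
      map_add' := fun a b => AddMonoidHom.ext fun x => congrArg ULift.up (add_act a b x.down) }

theorem IsUnitary.of_surjective {M N : Type*} [AddCommGroup M] [NonUnitalModule R M]
    [AddCommGroup N] [NonUnitalModule R N] (hM : IsUnitary R M) (f : M →+ N) (hf : IsHom R f)
    (hs : Function.Surjective f) : IsUnitary R N := by
  unfold IsUnitary at hM ⊢
  rw [eq_top_iff]
  rintro y -
  obtain ⟨x, rfl⟩ := hs y
  have hx : x ∈ AddSubgroup.closure {y : M | ∃ (a : R) (x : M), y = act a x} := hM ▸ trivial
  induction hx using AddSubgroup.closure_induction with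
  | mem x hx =>
    obtain ⟨a, z, rfl⟩ := hx
    exact AddSubgroup.subset_closure ⟨a, f z, hf a z⟩
  | zero => rw [map_zero]; exact zero_mem _
  | add x y _ _ h1 h2 => rw [map_add]; exact add_mem h1 h2
  | neg x _ h => rw [map_neg]; exact neg_mem h

/-- The map `a ↦ a • q`. -/
def orbitMap {M : Type m} [AddCommGroup M] [NonUnitalModule R M] (q : M) : R →+ M where
  toFun a := act a q
  map_zero' := zero_act q
  map_add' a b := add_act a b q

/-- `q` generates `M`, and `f q = q` for some `f` that is annihilated by the annihilator
of `q`. -/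
def IsSplitGenerator (R : Type r) [NonUnitalRing R] {M : Type m} [AddCommGroup M]
    [NonUnitalModule R M] (q : M) : Prop :=
  (∀ x : M, ∃ a : R, act a q = x) ∧ ∃ f : R, act f q = q ∧ ∀ a : R, act a q = 0 → a * f = 0

theorem isUnitary_of_generator {M : Type m} [AddCommGroup M] [NonUnitalModule R M] {q : M}
    (hq : ∀ x : M, ∃ a : R, act a q = x) : IsUnitary R M := by
  unfold IsUnitary
  rw [eq_top_iff]
  rintro x -
  obtain ⟨a, rfl⟩ := hq x
  exact AddSubgroup.subset_closure ⟨a, q, rfl⟩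

theorem isFG_of_generator {M : Type m} [AddCommGroup M] [NonUnitalModule R M] {q : M}
    (hq : ∀ x : M, ∃ a : R, act a q = x) : IsFG R (⊤ : AddSubgroup M) := by
  refine ⟨fun _ _ _ => trivial, {q}, fun _ _ => trivial, fun N' hN' hS x _ => ?_⟩
  obtain ⟨a, rfl⟩ := hq x
  exact hN' a q (hS (by simp))

/-- Right multiplication by `f` kills the annihilator of `q`, so `a q ↦ (a f) x₀` is well defined
for any preimage `x₀` of `φ q`. -/
theorem IsSplitGenerator.isProjective {M : Type m} [AddCommGroup M] [NonUnitalModule R M] {q : M}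
    (h : IsSplitGenerator R q) : IsProjective R M := by
  obtain ⟨hq, f, hfq, hann⟩ := h
  refine ⟨isUnitary_of_generator hq, ?_⟩
  intro X Y _ _ _ _ _ _ g φ hg hφ hsurj
  obtain ⟨x₀, hx₀⟩ := hsurj (φ q)
  choose c hc using hq
  -- The choice `c` need not be additive or `R`-linear; after multiplication by `f` it no longer
  -- matters.
  have key : ∀ a x, act a q = x → act (c x * f) x₀ = act (a * f) x₀ := by
    intro a x hax
    have : (c x - a) * f = 0 := hann _ (by rw [sub_act, hc, hax, sub_self])
    rw [sub_mul, sub_eq_zero] at this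
    rw [this]
  refine ⟨{ toFun := fun x => act (c x * f) x₀, map_zero' := ?_, map_add' := ?_ }, ?_, ?_⟩
  · rw [key 0 0 (zero_act q), zero_mul, zero_act]
  · intro x y
    rw [key (c x + c y) (x + y) (by rw [add_act, hc, hc]), add_mul, add_act]
  · intro a x
    change act (c (act a x) * f) x₀ = act a (act (c x * f) x₀)
    rw [key (a * c x) (act a x) (by rw [mul_act, hc]), mul_assoc, mul_act]
  · ext x
    change g (act (c x * f) x₀) = φ x
    rw [hg, hx₀, ← hφ, mul_act, hfq, hc]

theorem IsSplitGenerator.ulift {M : Type m} [AddCommGroup M] [NonUnitalModule R M] {q : M}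
    (h : IsSplitGenerator R q) : IsSplitGenerator R (ULift.up.{w} q) := by
  obtain ⟨hq, f, hfq, hann⟩ := h
  refine ⟨fun x => ?_, f, congrArg ULift.up hfq, fun a ha => hann a (congrArg ULift.down ha)⟩
  obtain ⟨a, ha⟩ := hq x.down
  exact ⟨a, congrArg ULift.up ha⟩

/-- `M` presents itself, with zero kernel; the copy only adjusts the universe. -/
theorem IsSplitGenerator.isFinitelyPresented {M : Type m} [AddCommGroup M] [NonUnitalModule R M]
    {q : M} (h : IsSplitGenerator R q) : IsFinitelyPresented R M := by
  refine ⟨isUnitary_of_generator h.1, ULift.{r} M, inferInstance, inferInstance,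
    downHom M, ?_, isFG_of_generator h.ulift.1, fun _ _ => rfl, ULift.down_surjective, ?_⟩
  · exact IsSplitGenerator.isProjective.{r, max r m} h.ulift.{r}
  · refine ⟨fun a x hx => ?_, ∅, by simp, fun N' _ _ x hx => ?_⟩
    · have hx' : x.down = 0 := hx
      change act a x.down = 0
      rw [hx', map_zero]
    · have hx' : x.down = 0 := hx
      have : x = 0 := congrArg ULift.up hx'
      rw [this]
      exact zero_mem _

/-- Lifting of a homomorphism from a projective module along `a ↦ a q`. -/
theorem IsProjective.exists_lift_orbitMap {P : Type (max w m)} [AddCommGroup P]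
    [NonUnitalModule R P] {M : Type m} [AddCommGroup M] [NonUnitalModule R M]
    (hR : IsUnitary R R) (hP : IsProjective.{r, max w m} R P) {q : M}
    (hq : ∀ x : M, ∃ a : R, act a q = x) (π : P →+ M) (hπ : IsHom R π) :
    ∃ h : P →+ R, IsHom R h ∧ ∀ y, act (h y) q = π y := by
  -- The lifting property tests modules of one fixed universe, so `R` and `M` are both moved there.
  have hX : IsUnitary R (ULift.{max w m} R) :=
    hR.of_surjective (upHom R) (fun _ _ => rfl) ULift.up_surjective
  have hY : IsUnitary R (ULift.{max w r} M) :=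
    (isUnitary_of_generator hq).of_surjective (upHom M) (fun _ _ => rfl)
      ULift.up_surjective
  obtain ⟨h, hh, hcomp⟩ := hP.2 (ULift.{max w m} R) (ULift.{max w r} M) hX hY
    ((upHom M).comp ((orbitMap q).comp (downHom R))) ((upHom M).comp π)
    (fun a x => congrArg ULift.up (mul_act a x.down q))
    (fun a x => congrArg ULift.up (hπ a x))
    (fun y => by
      obtain ⟨a, ha⟩ := hq y.down
      exact ⟨ULift.up a, congrArg ULift.up ha⟩)
  refine ⟨(downHom R).comp h, fun a x => congrArg ULift.down (hh a x),
    fun y => ?_⟩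
  exact congrArg ULift.down (DFunLike.congr_fun hcomp y)

/-- Lifting the identity gives a section `h` of `a ↦ a q`, and `f = h q` works because `a f = h (a
q)`. -/
theorem IsProjective.isSplitGenerator {M : Type m} [AddCommGroup M] [NonUnitalModule R M]
    (hR : IsUnitary R R) (hM : IsProjective R M) {q : M}
    (hq : ∀ x : M, ∃ a : R, act a q = x) : IsSplitGenerator R q := by
  obtain ⟨h, hh, hhq⟩ := IsProjective.exists_lift_orbitMap.{r, m, m} hR hM hq
    (AddMonoidHom.id M) (fun _ _ => rfl)
  refine ⟨hq, h q, hhq q, fun a ha => ?_⟩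
  rw [← act_regular, ← hh, ha, map_zero]

/-- If the annihilator of the generator `q` is the directed union of the left annihilators of
elements `u n` that fix `q`, then a finite presentation yields a splitting. -/
theorem IsFinitelyPresented.isSplitGenerator {M : Type m} [AddCommGroup M] [NonUnitalModule R M]
    (hR : IsUnitary R R) (hM : IsFinitelyPresented R M) {q : M}
    (hq : ∀ x : M, ∃ a : R, act a q = x) (u : ℕ → R) (hu : ∀ n, act (u n) q = q)
    (hann : ∀ a : R, act a q = 0 → ∀ᶠ n in Filter.atTop, a * u n = 0) :
    IsSplitGenerator R q := by
  obtain ⟨-, P, _, _, π, hP, -, hπ, hsurj, -, S, hS, hmin⟩ := hM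
  obtain ⟨h, hh, hhq⟩ := IsProjective.exists_lift_orbitMap.{r, m, r} hR hP hq π hπ
  -- `h` maps `π.ker` into the annihilator of `q`; finiteness of `S` gives one `n` for all
  -- generators.
  have hev : ∀ᶠ n in Filter.atTop, ∀ y ∈ S, h y * u n = 0 := by
    rw [Filter.eventually_all_finset]
    intro y hy
    exact hann _ ((hhq y).trans (hS hy))
  obtain ⟨n, hn⟩ := hev.exists
  -- Hence `y ↦ h y * u n` vanishes on `π.ker` and factors through `M`; the image of `q` is the
  -- required `f`.
  have hker : π.ker ≤ ((AddMonoidHom.mulRight (u n)).comp h).ker := by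
    refine hmin _ (fun a x hx => ?_) (fun y hy => hn y hy)
    have hx' : h x * u n = 0 := hx
    change h (act a x) * u n = 0
    rw [hh, act_regular, mul_assoc, hx', mul_zero]
  obtain ⟨y, hy⟩ := hsurj q
  refine ⟨hq, h y * u n, by rw [mul_act, hu, hhq, hy], fun a ha => ?_⟩
  have : h (act a y) * u n = 0 := hker (show π (act a y) = 0 by rw [hπ, hy, ha])
  rwa [hh, act_regular, mul_assoc] at this

end

end NonUnitalModule

/-! ### Aperiodicity of irrational paths -/

namespace DirectedGraph

variable {V : Type v} {E : Type e} {G : DirectedGraph V E}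

namespace InfinitePath

/-- Removal of the first `a` edges. -/
def drop (q : G.InfinitePath) (a : ℕ) : G.InfinitePath where
  edge n := q.edge (a + n)
  range_eq_source n := q.range_eq_source (a + n)

theorem TailEquiv.refl (p : G.InfinitePath) : p.TailEquiv p := ⟨0, 0, fun _ => rfl⟩

theorem TailEquiv.drop {p q : G.InfinitePath} (h : p.TailEquiv q) (c : ℕ) :
    p.TailEquiv (q.drop c) := by
  obtain ⟨a, b, h⟩ := h
  refine ⟨a + c, b, fun n => ?_⟩
  rw [add_assoc, h]
  change q.edge _ = q.edge _
  congr 1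
  omega

theorem isRational_of_periodic {p q : G.InfinitePath} (h : p.TailEquiv q) {a d : ℕ} (hd : 0 < d)
    (hper : ∀ i, q.edge (a + i) = q.edge (a + d + i)) : p.IsRational := by
  have hmod : ∀ n, q.edge (a + n) = q.edge (a + n % d) := by
    intro n
    induction n using Nat.strong_induction_on with
    | _ n ih =>
      by_cases hn : n < d
      · rw [Nat.mod_eq_of_lt hn]
      · have h1 := ih (n - d) (by omega)
        rw [← Nat.mod_eq_sub_mod (by omega), hper] at h1
        rw [← h1]
        congr 1
        omega
  refine ⟨List.ofFn fun i : Fin d => q.edge (a + i), q.vertex a, q.drop a, ⟨?_, ?_, ?_⟩, ?_,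
    h.drop a⟩
  · rw [List.isChain_iff_getElem]
    intro i hi
    simpa [add_assoc] using q.range_eq_source (a + i)
  · rw [List.head?_eq_getElem?]
    simp [hd, vertex]
  · rw [List.getLast?_eq_getElem?]
    have h1 : d - 1 < d := by omega
    have h2 := q.range_eq_source (a + (d - 1))
    -- The segment closes up: the edge following its last one is again the edge at position `a`.
    have h3 := hper 0
    have h4 : a + (d - 1) + 1 = a + d + 0 := by omega
    rw [h4, ← h3] at h2
    simp [h1, vertex, h2]
  · intro n
    have h1 : n % d < d := Nat.mod_lt _ hd
    simp [h1, drop, hmod n]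

/-- Equal tails at two different positions would make `q` periodic. This is the uniqueness of `α` in
`q = α p'`. -/
theorem IsIrrational.eq_of_drop_eq {p q : G.InfinitePath} (hp : p.IsIrrational)
    (h : p.TailEquiv q) {a b : ℕ} (hab : ∀ i, q.edge (a + i) = q.edge (b + i)) : a = b := by
  by_contra hne
  rcases Nat.lt_or_gt_of_ne hne with hlt | hlt
  · refine hp (isRational_of_periodic h (a := a) (d := b - a) (by omega) fun i => ?_)
    rw [hab]; congr 1; omega
  · refine hp (isRational_of_periodic h (a := b) (d := a - b) (by omega) fun i => ?_)
    rw [← hab]; congr 1; omega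

/-- Positivity of `a` ensures that `α` has a first edge for a ghost edge to act on. -/
theorem TailEquiv.eventually_exists_drop_eq {p q : G.InfinitePath} (h : p.TailEquiv q) :
    ∀ᶠ n in Filter.atTop, ∃ a, 0 < a ∧ ∀ i, q.edge (a + i) = p.edge (n + i) := by
  obtain ⟨a, b, h⟩ := h
  filter_upwards [Filter.eventually_gt_atTop a] with n hn
  refine ⟨b + (n - a), by omega, fun i => ?_⟩
  have := h (n - a + i)
  rw [← add_assoc, ← add_assoc] at this
  rw [← this]
  congr 1
  omega

/-- If no vertex of `p` from the `N`-th on is a bifurcation, then everything reachable from there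
lies on `p`. -/
theorem exists_vertex_eq_of_reaches {p : G.InfinitePath} {N : ℕ}
    (hN : ∀ n, N ≤ n → ¬ G.IsBifurcation (p.vertex n)) {u : V} (h : G.Reaches (p.vertex N) u) :
    ∃ n, N ≤ n ∧ u = p.vertex n := by
  induction h with
  | refl => exact ⟨N, le_rfl, rfl⟩
  | tail _ hx ih =>
    obtain ⟨n, hn, rfl⟩ := ih
    obtain ⟨x, hx, rfl⟩ := hx
    have : x = p.edge n := by
      by_contra hne
      exact hN n hn ⟨x, p.edge n, hne, hx, rfl⟩
    exact ⟨n + 1, by omega, this ▸ p.range_eq_source n⟩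

/-- Without bifurcations, a finite path starting on `p` is forced to follow `p`. -/
theorem range_getLast_eq_vertex {p : G.InfinitePath} {N : ℕ}
    (hN : ∀ n, N ≤ n → ¬ G.IsBifurcation (p.vertex n)) (x : E) (c : List E) {n : ℕ} (hn : N ≤ n)
    (hc : (x :: c).IsChain (fun x y => G.r x = G.s y)) (hx : G.s x = p.vertex n) :
    G.r ((x :: c).getLast (List.cons_ne_nil x c)) = p.vertex (n + 1 + c.length) := by
  have hxe : x = p.edge n := by
    by_contra hne
    exact hN n hn ⟨x, p.edge n, hne, hx, rfl⟩
  induction c generalizing x n with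
  | nil => rw [List.getLast_singleton, hxe]; exact p.range_eq_source n
  | cons y c ih =>
    rw [List.isChain_cons_cons] at hc
    have hy : G.s y = p.vertex (n + 1) := by
      rw [← hc.1, hxe]; exact p.range_eq_source n
    have hye : y = p.edge (n + 1) := by
      by_contra hne
      exact hN (n + 1) (by omega) ⟨y, p.edge (n + 1), hne, hy, rfl⟩
    rw [List.getLast_cons_cons, ih y (by omega) hc.2 hy hye]
    simp only [List.length_cons]
    congr 1
    omega

/-- A cycle at a later vertex would have to run along `p` and return, making `p` periodic. -/
theorem IsIrrational.isLinePoint {p : G.InfinitePath} (hp : p.IsIrrational) {N : ℕ}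
    (hN : ∀ n, N ≤ n → ¬ G.IsBifurcation (p.vertex n)) : G.IsLinePoint (p.vertex N) := by
  intro u hu
  obtain ⟨n, hn, rfl⟩ := exists_vertex_eq_of_reaches hN hu
  refine ⟨hN n hn, ?_⟩
  rintro ⟨c, ⟨hc, hhead, hlast⟩, -⟩
  cases c with
  | nil => simp at hhead
  | cons x c =>
    rw [List.head?_cons, Option.map_some, Option.some_inj] at hhead
    rw [List.getLast?_eq_getLast_of_ne_nil (List.cons_ne_nil x c), Option.map_some,
      Option.some_inj, range_getLast_eq_vertex hN x c hn hc hhead] at hlast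
    -- Equal vertices have equal unique exits, hence equal successors, so the coincidence
    -- propagates.
    have hvert : ∀ i, p.vertex (n + 1 + c.length + i) = p.vertex (n + i) := by
      intro i
      induction i with
      | zero => exact hlast
      | succ i ih =>
        have : p.edge (n + 1 + c.length + i) = p.edge (n + i) := by
          by_contra hne
          exact hN (n + i) (by omega) ⟨_, _, hne, ih, rfl⟩
        have h1 := p.range_eq_source (n + 1 + c.length + i)
        rw [this] at h1
        exact h1.symm.trans (p.range_eq_source (n + i))
    have := hp.eq_of_drop_eq (TailEquiv.refl p) (a := n) (b := n + 1 + c.length) (fun i => by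
      by_contra hne
      exact hN (n + i) (by omega) ⟨_, _, hne, rfl, hvert i⟩)
    omega

theorem reaches_vertex (p : G.InfinitePath) {N n : ℕ} (h : N ≤ n) :
    G.Reaches (p.vertex N) (p.vertex n) := by
  induction n, h using Nat.le_induction with
  | base => exact Relation.ReflTransGen.refl
  | succ n _ ih => exact ih.tail ⟨p.edge n, rfl, p.range_eq_source n⟩

end InfinitePath

end DirectedGraph

/-! ### Vertices of a Leavitt path algebra do not vanish -/

section Faithful

open LeavittGen

/-- For an infinite set `C` at least as large as the set of edges, there is for every vertex `w`
that emits edges a bijection between `s⁻¹(w) × C` and `C`. -/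
theorem DirectedGraph.exists_branching {V : Type v} {E : Type e} (G : DirectedGraph V E) :
    ∃ U : E → (ℕ ⊕ E) → (ℕ ⊕ E),
      (∀ x y c d, G.s x = G.s y → U x c = U y d → x = y ∧ c = d) ∧
      ∀ x c, ∃ y d, G.s y = G.s x ∧ U y d = c := by
  have heq : ∀ w : V, Nonempty {x : E // G.s x = w} →
      Nonempty ({x : E // G.s x = w} × (ℕ ⊕ E) ≃ (ℕ ⊕ E)) := by
    intro w hw
    refine Cardinal.eq.1 ?_
    rw [Cardinal.mk_prod, Cardinal.lift_id, Cardinal.lift_id]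
    -- An infinite cardinal absorbs a nonzero factor that is no larger.
    refine Cardinal.mul_eq_right (Cardinal.aleph0_le_mk _) ?_ (Cardinal.mk_ne_zero_iff.2 hw)
    exact Cardinal.mk_le_of_injective (f := fun x => Sum.inr x.1) fun x y h =>
      Subtype.ext (Sum.inr_injective h)
  have Ψ : ∀ w : V, Nonempty {x : E // G.s x = w} →
      ({x : E // G.s x = w} × (ℕ ⊕ E) ≃ (ℕ ⊕ E)) := fun w hw => (heq w hw).some
  refine ⟨fun x c => Ψ (G.s x) ⟨x, rfl⟩ (⟨x, rfl⟩, c), ?_, ?_⟩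
  · intro x y c d hxy h
    -- The sources are only propositionally equal; a free `w` allows both bijections to be compared
    -- at one vertex.
    have key : ∀ (w : V) (hw : G.s y = w) (hx : G.s x = w),
        Ψ w ⟨x, hx⟩ (⟨x, hx⟩, c) = Ψ w ⟨y, hw⟩ (⟨y, hw⟩, d) → x = y ∧ c = d := by
      intro w hw hx h
      have := (Ψ w ⟨x, hx⟩).injective h
      simpa using this
    refine key (G.s x) hxy.symm rfl (h.trans ?_)
    have : ∀ (w : V) (hw : G.s y = w), Ψ (G.s y) ⟨y, rfl⟩ (⟨y, rfl⟩, d) =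
        Ψ w ⟨y, hw⟩ (⟨y, hw⟩, d) := by
      rintro w rfl; rfl
    exact this _ hxy.symm
  · intro x c
    obtain ⟨⟨⟨y, hy⟩, d⟩, h⟩ := (Ψ (G.s x) ⟨x, rfl⟩).surjective c
    refine ⟨y, d, hy, ?_⟩
    rw [← h]
    have : ∀ (w : V) (hw : G.s y = w), Ψ (G.s y) ⟨y, rfl⟩ (⟨y, rfl⟩, d) =
        Ψ w ⟨y, hw⟩ (⟨y, hw⟩, d) := by
      rintro w rfl; rfl
    exact this _ hy

variable (K : Type k) [Field K] {V : Type v} {E : Type e} (G : DirectedGraph V E)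
  {C : Type w} (U : E → C → C)

open Classical in
/-- The operators on functions on `V × C` defined by a branching system. -/
noncomputable def branchingAct : LeavittGen V E → Module.End K (V × C → K)
  | .vertex u =>
    { toFun := fun f y => if y.1 = u then f y else 0
      map_add' := fun f g => by ext y; dsimp; split_ifs <;> simp
      map_smul' := fun c f => by ext y; dsimp; split_ifs <;> simp }
  | .edge x =>
    { toFun := fun f y => if h : ∃ c, y = (G.s x, U x c) then f (G.r x, h.choose) else 0
      map_add' := fun f g => by ext y; dsimp; split_ifs <;> simp
      map_smul' := fun c f => by ext y; dsimp; split_ifs <;> simp }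
  | .ghost x =>
    { toFun := fun f y => if y.1 = G.r x then f (G.s x, U x y.2) else 0
      map_add' := fun f g => by ext y; dsimp; split_ifs <;> simp
      map_smul' := fun c f => by ext y; dsimp; split_ifs <;> simp }

variable {K U}

open Classical in
theorem branchingAct_vertex (u : V) (f : V × C → K) (y : V × C) :
    branchingAct K G U (vertex u) f y = if y.1 = u then f y else 0 := rfl

open Classical in
theorem branchingAct_ghost (x : E) (f : V × C → K) (y : V × C) :
    branchingAct K G U (ghost x) f y = if y.1 = G.r x then f (G.s x, U x y.2) else 0 := rfl

theorem branchingAct_edge_of_not (x : E) (f : V × C → K) (y : V × C)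
    (h : ¬ ∃ c, y = (G.s x, U x c)) : branchingAct K G U (edge x) f y = 0 :=
  dif_neg h

variable {G} in
theorem branchingAct_edge (hU : ∀ x y c d, G.s x = G.s y → U x c = U y d → x = y ∧ c = d)
    (x : E) (f : V × C → K) (c : C) :
    branchingAct K G U (edge x) f (G.s x, U x c) = f (G.r x, c) := by
  have h : ∃ d, (G.s x, U x c) = (G.s x, U x d) := ⟨c, rfl⟩
  refine (dif_pos h).trans ?_
  have := (hU x x _ _ rfl (congrArg Prod.snd h.choose_spec)).2
  rw [← this]

-- `hU`, injectivity and disjointness of images, yields the relations for `x* y`; `hU'`, covering,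
-- yields the summation relation at regular vertices.
variable {G} in
theorem isLeavittFamily_branchingAct
    (hU : ∀ x y c d, G.s x = G.s y → U x c = U y d → x = y ∧ c = d)
    (hU' : ∀ x c, ∃ y d, G.s y = G.s x ∧ U y d = c) :
    IsLeavittFamily G (branchingAct K G U) := by
  classical
  constructor
  · intro u
    ext f y
    simp only [Module.End.mul_apply, branchingAct_vertex]
    split_ifs <;> rfl
  · intro u u' h
    ext f y
    simp only [Module.End.mul_apply, branchingAct_vertex]
    split_ifs with h1 h2
    · exact absurd (h1.symm.trans h2) h
    · rfl
    · rfl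
  · intro x
    ext f y
    simp only [Module.End.mul_apply, branchingAct_vertex]
    split_ifs with h1
    · rfl
    · rw [branchingAct_edge_of_not]
      rintro ⟨c, rfl⟩
      exact h1 rfl
  · intro x
    ext f y
    rw [Module.End.mul_apply]
    by_cases h : ∃ c, y = (G.s x, U x c)
    · obtain ⟨c, rfl⟩ := h
      rw [branchingAct_edge hU, branchingAct_edge hU, branchingAct_vertex, if_pos rfl]
    · rw [branchingAct_edge_of_not _ _ _ _ h, branchingAct_edge_of_not _ _ _ _ h]
  · intro x
    ext f y
    simp only [Module.End.mul_apply, branchingAct_vertex, branchingAct_ghost]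
    split_ifs <;> rfl
  · intro x
    ext f y
    simp only [Module.End.mul_apply, branchingAct_vertex, branchingAct_ghost, if_true]
  · intro x
    ext f y
    obtain ⟨u, c⟩ := y
    simp only [Module.End.mul_apply, branchingAct_vertex, branchingAct_ghost,
      branchingAct_edge hU]
    split_ifs with h
    · subst h; rfl
    · rfl
  · intro x y hxy
    ext f z
    simp only [Module.End.mul_apply, branchingAct_ghost]
    split_ifs with h
    · rw [branchingAct_edge_of_not]
      · rfl
      · rintro ⟨c, hc⟩
        rw [Prod.mk.injEq] at hc
        exact hxy (hU x y _ _ hc.1 hc.2).1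
    · rfl
  · intro u S hS hmem
    ext f z
    rw [LinearMap.sum_apply, Finset.sum_apply, branchingAct_vertex]
    split_ifs with h
    · obtain ⟨u', c⟩ := z
      obtain ⟨x, hx⟩ := hS
      rw [hmem] at hx
      dsimp only at h
      subst h
      obtain ⟨y, d, hy, rfl⟩ := hU' x c
      rw [hx] at hy
      -- Only the edge whose image contains the given point contributes.
      rw [Finset.sum_eq_single_of_mem y ((hmem y).2 hy)]
      · subst hy
        rw [Module.End.mul_apply, branchingAct_edge hU, branchingAct_ghost, if_pos rfl]
      · intro x' hx' hne
        rw [Module.End.mul_apply, branchingAct_edge_of_not]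
        rintro ⟨c', hc'⟩
        rw [Prod.mk.injEq] at hc'
        exact hne (hU y x' _ _ (hy.trans hc'.1) hc'.2).1.symm
    · refine (Finset.sum_eq_zero fun x hx => ?_).symm
      rw [Module.End.mul_apply, branchingAct_edge_of_not]
      rintro ⟨c, rfl⟩
      exact h ((hmem x).1 hx)

-- This is needed at the range of an edge branching off `p`, which may lie on no path in `[p]` and
-- so act as zero on `V_[p]`; hence the separate representation.
variable (K) in
theorem LeavittPathAlgebra.gen_vertex_ne_zero (u : V) :
    (gen (vertex u) : LeavittPathAlgebra K G) ≠ 0 := by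
  intro h
  obtain ⟨U, hU, hU'⟩ := G.exists_branching
  have hfam := isLeavittFamily_branchingAct (K := K) hU hU'
  obtain ⟨φ, hφ, -⟩ := existsUnique_lift (K := K) hfam
  have h1 := hφ (vertex u)
  rw [h, map_zero] at h1
  have h2 := congrFun (LinearMap.congr_fun h1 (fun _ => 1)) (u, Sum.inl 0)
  rw [branchingAct_vertex, if_pos rfl] at h2
  exact zero_ne_one h2

end Faithful

/-! ### Finite segments of infinite paths in the Leavitt path algebra -/

namespace LeavittPathAlgebra

open LeavittGen DirectedGraph InfinitePath

variable {K : Type k} [Field K] {V : Type v} {E : Type e} {G : DirectedGraph V E}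

variable (K) in
/-- The path consisting of the first `a` edges of `q`. -/
noncomputable def seg (q : G.InfinitePath) : ℕ → LeavittPathAlgebra K G
  | 0 => gen (vertex (q.vertex 0))
  | a + 1 => gen (edge (q.edge 0)) * seg q.tail a

variable (K) in
/-- The ghost path of the path consisting of the first `a` edges of `q`. -/
noncomputable def ghostSeg (q : G.InfinitePath) : ℕ → LeavittPathAlgebra K G
  | 0 => gen (vertex (q.vertex 0))
  | a + 1 => ghostSeg q.tail a * gen (ghost (q.edge 0))

theorem vertex_mul_seg (q : G.InfinitePath) (a : ℕ) :
    gen (vertex (q.vertex 0)) * seg K q a = seg K q a := by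
  cases a with
  | zero => exact isLeavittFamily_gen.idem _
  | succ a => rw [seg, ← mul_assoc, InfinitePath.vertex, isLeavittFamily_gen.source_edge]

theorem seg_mul_vertex (q : G.InfinitePath) (a : ℕ) :
    seg K q a * gen (vertex (q.vertex a)) = seg K q a := by
  induction a generalizing q with
  | zero => exact isLeavittFamily_gen.idem _
  | succ a ih =>
    have := ih q.tail
    rw [seg, mul_assoc]
    exact congrArg _ this

theorem vertex_mul_ghostSeg (q : G.InfinitePath) (a : ℕ) :
    gen (vertex (q.vertex a)) * ghostSeg K q a = ghostSeg K q a := by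
  induction a generalizing q with
  | zero => exact isLeavittFamily_gen.idem _
  | succ a ih =>
    have := ih q.tail
    rw [ghostSeg, ← mul_assoc]
    exact congrArg (· * _) this

/-- `seg` is built from its first edge, as left multiplication by generators requires; comparing
successive `segIdem` requires the last edge. -/
theorem seg_succ (q : G.InfinitePath) (a : ℕ) :
    seg K q (a + 1) = seg K q a * gen (edge (q.edge a)) := by
  induction a generalizing q with
  | zero =>
    have h : q.tail.vertex 0 = G.r (q.edge 0) := (q.range_eq_source 0).symm
    rw [seg, seg, seg, h, isLeavittFamily_gen.edge_range, InfinitePath.vertex,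
      isLeavittFamily_gen.source_edge]
  | succ a ih =>
    rw [seg, ih q.tail, ← mul_assoc]
    rfl

theorem ghostSeg_succ (q : G.InfinitePath) (a : ℕ) :
    ghostSeg K q (a + 1) = gen (ghost (q.edge a)) * ghostSeg K q a := by
  induction a generalizing q with
  | zero =>
    have h : q.tail.vertex 0 = G.r (q.edge 0) := (q.range_eq_source 0).symm
    rw [ghostSeg, ghostSeg, ghostSeg, h, isLeavittFamily_gen.range_ghost, InfinitePath.vertex,
      isLeavittFamily_gen.ghost_source]
  | succ a ih =>
    rw [ghostSeg, ih q.tail, mul_assoc]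
    rfl

theorem ghostSeg_mul_seg (q : G.InfinitePath) (a : ℕ) :
    ghostSeg K q a * seg K q a = gen (vertex (q.vertex a)) := by
  induction a with
  | zero => exact isLeavittFamily_gen.idem _
  | succ a ih =>
    rw [ghostSeg_succ, seg_succ, mul_assoc, ← mul_assoc (ghostSeg K q a), ih,
      InfinitePath.vertex, isLeavittFamily_gen.source_edge, isLeavittFamily_gen.ck1,
      InfinitePath.vertex, ← q.range_eq_source]

/-! ### The idempotents attached to initial segments -/

variable (K) in
/-- The idempotent `α α*` for the path `α` consisting of the first `n` edges of `p`. -/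
noncomputable def segIdem (p : G.InfinitePath) (n : ℕ) : LeavittPathAlgebra K G :=
  seg K p n * ghostSeg K p n

theorem segIdem_mul_seg (p : G.InfinitePath) (n : ℕ) :
    segIdem K p n * seg K p n = seg K p n := by
  rw [segIdem, mul_assoc, ghostSeg_mul_seg, seg_mul_vertex]

/-- At a bifurcation the idempotents strictly decrease. -/
theorem not_isBifurcation_of_segIdem {p : G.InfinitePath} {n : ℕ}
    (h : segIdem K p (n + 1) * segIdem K p n = segIdem K p n) :
    ¬ G.IsBifurcation (p.vertex n) := by
  intro hb
  obtain ⟨x, hne, hx⟩ : ∃ x, p.edge n ≠ x ∧ G.s x = p.vertex n := by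
    obtain ⟨x, y, hxy, hx, hy⟩ := hb
    by_cases h : p.edge n = x
    · exact ⟨y, fun h' => hxy (h.symm.trans h'), hy⟩
    · exact ⟨x, h, hx⟩
  -- With `β = seg K p n`, the element `β x` is fixed by `segIdem K p n` but killed by `segIdem K p
  -- (n + 1)`, as `(p.edge n)* x = 0`.
  have h1 : seg K p n * gen (edge x) = 0 := by
    have h2 := congrArg (fun z => z * seg K p n * gen (edge x)) h
    simp only [mul_assoc] at h2
    rw [← mul_assoc (segIdem K p n), segIdem_mul_seg] at h2
    rw [← h2, segIdem, ghostSeg_succ, mul_assoc, mul_assoc, ← mul_assoc (ghostSeg K p n),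
      ghostSeg_mul_seg, ← hx, isLeavittFamily_gen.source_edge, isLeavittFamily_gen.ck1' _ _ hne,
      mul_zero]
  have h2 : (gen (edge x) : LeavittPathAlgebra K G) = 0 := by
    rw [← isLeavittFamily_gen.source_edge, hx, ← ghostSeg_mul_seg, mul_assoc, h1, mul_zero]
  refine gen_vertex_ne_zero K G (G.r x) ?_
  rw [← isLeavittFamily_gen.ck1, h2, mul_zero]

/-- When `p.edge n` is the only edge emitted, `ck2` lets the inner `e e*` collapse to a vertex. -/
theorem segIdem_succ {p : G.InfinitePath} {n : ℕ} (h : ¬ G.IsBifurcation (p.vertex n)) :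
    segIdem K p (n + 1) = segIdem K p n := by
  have h1 := isLeavittFamily_gen (K := K).ck2 (p.vertex n) {p.edge n} (by simp) fun x => by
    rw [Finset.mem_singleton]
    refine ⟨fun hx => congrArg G.s hx, fun hx => ?_⟩
    by_contra hne
    exact h ⟨x, _, hne, hx, rfl⟩
  rw [Finset.sum_singleton] at h1
  rw [segIdem, seg_succ, ghostSeg_succ, mul_assoc, ← mul_assoc (gen (edge _)), ← h1,
    vertex_mul_ghostSeg, segIdem]

theorem segIdem_eq {p : G.InfinitePath} {N : ℕ} (hp : G.IsLinePoint (p.vertex N)) {n : ℕ}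
    (hn : N ≤ n) : segIdem K p n = segIdem K p N := by
  induction n, hn using Nat.le_induction with
  | base => rfl
  | succ n hn ih => rw [segIdem_succ (hp _ (p.reaches_vertex hn)).1, ih]

/-- This admits `L` as a test module, so that maps can be lifted along `a ↦ a q`. -/
theorem isUnitary : NonUnitalModule.IsUnitary (LeavittPathAlgebra K G)
    (LeavittPathAlgebra K G) := by
  unfold NonUnitalModule.IsUnitary
  rw [eq_top_iff]
  rintro a -
  induction a using gen_induction with
  | hgen g =>
    refine AddSubgroup.subset_closure ?_
    cases g with
    | vertex u => exact ⟨_, _, (isLeavittFamily_gen.idem u).symm⟩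
    | edge x => exact ⟨_, _, (isLeavittFamily_gen.source_edge x).symm⟩
    | ghost x => exact ⟨_, _, (isLeavittFamily_gen.range_ghost x).symm⟩
  | hadd a b ha hb => exact add_mem ha hb
  | hzero => exact zero_mem _
  | hmul a b _ _ => exact AddSubgroup.subset_closure ⟨a, b, rfl⟩
  | hsmul c a ha =>
    induction ha using AddSubgroup.closure_induction with
    | mem a ha =>
      obtain ⟨x, y, rfl⟩ := ha
      exact AddSubgroup.subset_closure ⟨c • x, y, (smul_mul_assoc c x y).symm⟩
    | zero => rw [smul_zero]; exact zero_mem _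
    | add x y _ _ hx hy => rw [smul_add]; exact add_mem hx hy
    | neg x _ hx => rw [smul_neg]; exact neg_mem hx

end LeavittPathAlgebra

/-! ### Chen modules of irrational paths -/

namespace ChenModule

open LeavittGen DirectedGraph InfinitePath LeavittPathAlgebra NonUnitalModule

variable {K : Type k} [Field K] {V : Type v} {E : Type e} {G : DirectedGraph V E}
  {p : G.InfinitePath}

theorem act_smul (a : LeavittPathAlgebra K G) (c : K) (x : ChenModule K p) :
    act a (c • x) = c • act a x :=
  (UnitizedLeavitt.lift (isLeavittFamily_genAct K p) (incl K G a)).map_smul c x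

theorem smul_act (a : LeavittPathAlgebra K G) (c : K) (x : ChenModule K p) :
    act (c • a) x = c • act a x := by
  change UnitizedLeavitt.lift (isLeavittFamily_genAct K p) (incl K G (c • a)) x =
    c • UnitizedLeavitt.lift (isLeavittFamily_genAct K p) (incl K G a) x
  rw [map_smul, map_smul]
  rfl

theorem induction_basis {P : ChenModule K p → Prop} (h0 : P 0)
    (hadd : ∀ x y, P x → P y → P (x + y)) (hsmul : ∀ (c : K) x, P x → P (c • x))
    (hbasis : ∀ q, P (basis K q)) (x : ChenModule K p) : P x := by
  induction x using Finsupp.induction_linear with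
  | zero => exact h0
  | add x y hx hy => exact hadd x y hx hy
  | single q c =>
    have : (Finsupp.single q c : p.TailClass →₀ K) = c • Finsupp.single q 1 := by simp
    rw [this]
    exact hsmul c _ (hbasis q)

theorem basis_congr {q q' : p.TailClass} (h : ∀ i, q.1.edge i = q'.1.edge i) :
    basis K q = basis K q' := by
  congr 1
  exact Subtype.ext (InfinitePath.ext (funext h))

theorem act_ghostSeg (q : p.TailClass) (a : ℕ) :
    act (ghostSeg K q.1 a) (basis K q) = basis K ⟨q.1.drop a, q.2.drop a⟩ := by
  induction a generalizing q with
  | zero =>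
    rw [ghostSeg, act_gen_basis, genOnBasis, if_pos rfl]
    exact basis_congr fun i => by simp [InfinitePath.drop]
  | succ a ih =>
    rw [ghostSeg, mul_act, act_gen_basis, genOnBasis, if_pos rfl]
    refine (ih ⟨q.1.tail, q.2.tail⟩).trans (basis_congr fun i => ?_)
    simp only [InfinitePath.drop, InfinitePath.tail]
    congr 1
    omega

theorem act_seg (q : p.TailClass) (a : ℕ) :
    act (seg K q.1 a) (basis K ⟨q.1.drop a, q.2.drop a⟩) = basis K q := by
  induction a generalizing q with
  | zero =>
    have h : (q.1.drop 0).vertex 0 = q.1.vertex 0 := rfl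
    rw [seg, act_gen_basis, genOnBasis, if_pos h]
    exact basis_congr fun i => by simp [InfinitePath.drop]
  | succ a ih =>
    have h1 : basis K (⟨q.1.drop (a + 1), q.2.drop (a + 1)⟩ : p.TailClass) =
        basis K ⟨q.1.tail.drop a, q.2.tail.drop a⟩ := basis_congr fun i => by
      simp only [InfinitePath.drop, InfinitePath.tail]
      congr 1
      omega
    have h2 : G.r (q.1.edge 0) = q.1.tail.vertex 0 := q.1.range_eq_source 0
    rw [seg, mul_act, h1, ih ⟨q.1.tail, q.2.tail⟩, act_gen_basis, genOnBasis, dif_pos h2]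
    exact basis_congr fun i => by cases i <;> rfl

/-! ### Approximate sections of the orbit map -/

variable (K) in
/-- The basis vector `p` of `V_[p]`. -/
noncomputable def self (p : G.InfinitePath) : ChenModule K p := basis K ⟨p, TailEquiv.refl p⟩

open Classical in
variable (K) in
/-- The element `α β*`, where `β` consists of the first `n` edges of `p` and `q = α p'` for
`p = β p'`, if there is such a path `α`. -/
noncomputable def monomial (n : ℕ) (q : p.TailClass) : LeavittPathAlgebra K G :=
  -- For irrational `p` the choice is unique; for each `q` the value `0` is taken for only finitely
  -- many `n`.
  if h : ∃ a, ∀ i, q.1.edge (a + i) = p.edge (n + i) then seg K q.1 h.choose * ghostSeg K p n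
  else 0

theorem monomial_eq (hp : p.IsIrrational) {n : ℕ} {q : p.TailClass} {a : ℕ}
    (ha : ∀ i, q.1.edge (a + i) = p.edge (n + i)) :
    monomial K n q = seg K q.1 a * ghostSeg K p n := by
  have h : ∃ a, ∀ i, q.1.edge (a + i) = p.edge (n + i) := ⟨a, ha⟩
  rw [monomial, dif_pos h, hp.eq_of_drop_eq q.2 fun i => (h.choose_spec i).trans (ha i).symm]

theorem act_monomial (hp : p.IsIrrational) {n : ℕ} {q : p.TailClass} {a : ℕ}
    (ha : ∀ i, q.1.edge (a + i) = p.edge (n + i)) :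
    act (monomial K n q) (self K p) = basis K q := by
  have h := act_ghostSeg (K := K) (⟨p, TailEquiv.refl p⟩ : p.TailClass) n
  rw [monomial_eq hp ha, mul_act, self, h, ← act_seg q a]
  congr 1
  exact basis_congr fun i => (ha i).symm

variable (K p) in
/-- The linear extension of `monomial`, an approximate section of `a ↦ a p`. -/
noncomputable def approxSection (n : ℕ) : ChenModule K p →ₗ[K] LeavittPathAlgebra K G :=
  Finsupp.linearCombination K (monomial K n)

theorem approxSection_basis (n : ℕ) (q : p.TailClass) :
    approxSection K p n (basis K q) = monomial K n q :=
  (Finsupp.linearCombination_single K (1 : K) q).trans (one_smul _ _)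

theorem approxSection_self (hp : p.IsIrrational) (n : ℕ) :
    approxSection K p n (self K p) = segIdem K p n := by
  rw [self, approxSection_basis, monomial_eq hp fun _ => rfl, segIdem]

theorem act_segIdem (hp : p.IsIrrational) (n : ℕ) : act (segIdem K p n) (self K p) = self K p := by
  rw [← approxSection_self hp, self, approxSection_basis]
  exact act_monomial hp fun _ => rfl

/-- A vector involves finitely many basis paths, each of which has its `α` for all large `n`. -/
theorem eventually_act_approxSection (hp : p.IsIrrational) (x : ChenModule K p) :
    ∀ᶠ n in Filter.atTop, act (approxSection K p n x) (self K p) = x := by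
  induction x using induction_basis with
  | h0 => exact .of_forall fun n => by rw [map_zero, zero_act]
  | hadd x y hx hy =>
    filter_upwards [hx, hy] with n hx hy
    rw [map_add, add_act, hx, hy]
  | hsmul c x hx =>
    filter_upwards [hx] with n hx
    rw [map_smul, smul_act, hx]
  | hbasis q =>
    filter_upwards [q.2.eventually_exists_drop_eq] with n hn
    obtain ⟨a, -, ha⟩ := hn
    rw [approxSection_basis, act_monomial hp ha]

/-- If `α` were a vertex, `x* α βₙ*` would lengthen the ghost part and leave level `n`; `hpos`
excludes this. -/
theorem gen_mul_monomial (hp : p.IsIrrational) (g : LeavittGen V E) {n : ℕ} {q : p.TailClass}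
    {a : ℕ} (hpos : 0 < a) (ha : ∀ i, q.1.edge (a + i) = p.edge (n + i)) :
    gen g * monomial K n q = approxSection K p n (genOnBasis K g q) := by
  rw [monomial_eq hp ha, ← mul_assoc]
  cases g with
  | vertex u =>
    rw [genOnBasis]
    split_ifs with h
    · rw [← h, vertex_mul_seg, approxSection_basis, monomial_eq hp ha]
    · rw [← vertex_mul_seg, ← mul_assoc, isLeavittFamily_gen.orth _ _ (Ne.symm h), zero_mul,
        zero_mul, map_zero]
  | edge x =>
    rw [genOnBasis]
    split_ifs with h
    · rw [approxSection_basis, monomial_eq hp (a := a + 1)]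
      · rfl
      · intro i
        rw [← ha, show a + 1 + i = a + i + 1 by omega]
        rfl
    · rw [← isLeavittFamily_gen.edge_range, ← vertex_mul_seg, mul_assoc (gen (edge x)),
        ← mul_assoc (gen (vertex _)), isLeavittFamily_gen.orth _ _ h, zero_mul, mul_zero,
        zero_mul, map_zero]
  | ghost x =>
    obtain ⟨a, rfl⟩ : ∃ b, a = b + 1 := ⟨a - 1, by omega⟩
    rw [genOnBasis, seg, ← mul_assoc]
    split_ifs with h
    · have h2 : G.r (q.1.edge 0) = q.1.tail.vertex 0 := q.1.range_eq_source 0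
      rw [approxSection_basis, monomial_eq hp (a := a), ← h, isLeavittFamily_gen.ck1, h2,
        vertex_mul_seg]
      intro i
      rw [← ha, show a + 1 + i = a + i + 1 by omega]
      rfl
    · rw [isLeavittFamily_gen.ck1' _ _ (Ne.symm h), zero_mul, zero_mul, map_zero]

/-- The maps `approxSection` are asymptotically homomorphisms of modules. -/
theorem eventually_mul_approxSection (hp : p.IsIrrational) (a : LeavittPathAlgebra K G)
    (x : ChenModule K p) :
    ∀ᶠ n in Filter.atTop, a * approxSection K p n x = approxSection K p n (act a x) := by
  induction a using gen_induction generalizing x with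
  | hgen g =>
    induction x using induction_basis with
    | h0 => exact .of_forall fun n => by simp
    | hadd x y hx hy =>
      filter_upwards [hx, hy] with n hx hy
      rw [map_add, mul_add, hx, hy, map_add, map_add]
    | hsmul c x hx =>
      filter_upwards [hx] with n hx
      rw [map_smul, mul_smul_comm, hx, act_smul, map_smul]
    | hbasis q =>
      filter_upwards [q.2.eventually_exists_drop_eq] with n hn
      obtain ⟨a, hpos, ha⟩ := hn
      rw [approxSection_basis, gen_mul_monomial hp g hpos ha, act_gen_basis]
  | hadd a b ha hb =>
    filter_upwards [ha x, hb x] with n ha hb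
    rw [add_mul, ha, hb, add_act, map_add]
  | hzero => exact .of_forall fun n => by rw [zero_mul, zero_act, map_zero]
  | hmul a b ha hb =>
    filter_upwards [ha (act b x), hb x] with n ha hb
    rw [mul_assoc, hb, ha, mul_act]
  | hsmul c a ha =>
    filter_upwards [ha x] with n ha
    rw [smul_mul_assoc, ha, smul_act, map_smul]

theorem eventually_mul_segIdem (hp : p.IsIrrational) (a : LeavittPathAlgebra K G) :
    ∀ᶠ n in Filter.atTop,
      a * segIdem K p n = approxSection K p n (act a (self K p)) := by
  filter_upwards [eventually_mul_approxSection hp a (self K p)] with n hn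
  rw [← hn, approxSection_self hp]

/-- This is the annihilator hypothesis of `IsFinitelyPresented.isSplitGenerator`. -/
theorem eventually_mul_segIdem_eq_zero (hp : p.IsIrrational) (a : LeavittPathAlgebra K G)
    (ha : act a (self K p) = 0) : ∀ᶠ n in Filter.atTop, a * segIdem K p n = 0 := by
  filter_upwards [eventually_mul_segIdem hp a] with n hn
  rw [hn, ha, map_zero]

theorem exists_act_self (hp : p.IsIrrational) (x : ChenModule K p) :
    ∃ a : LeavittPathAlgebra K G, act a (self K p) = x :=
  let ⟨n, hn⟩ := (eventually_act_approxSection hp x).exists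
  ⟨approxSection K p n x, hn⟩

/-- From `N` on the idempotents are constant, so annihilation by a late one is annihilation by the
`N`-th. -/
theorem isSplitGenerator_of_isLinePoint (hp : p.IsIrrational) {N : ℕ}
    (hN : G.IsLinePoint (p.vertex N)) : IsSplitGenerator (LeavittPathAlgebra K G) (self K p) := by
  refine ⟨exists_act_self hp, segIdem K p N, act_segIdem hp N, fun a ha => ?_⟩
  obtain ⟨n, hn, hle⟩ :=
    ((eventually_mul_segIdem_eq_zero hp a ha).and (Filter.eventually_ge_atTop N)).exists
  rwa [segIdem_eq hN hle] at hn

theorem exists_isLinePoint (hp : p.IsIrrational)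
    (h : IsSplitGenerator (LeavittPathAlgebra K G) (self K p)) :
    ∃ n, G.IsLinePoint (p.vertex n) := by
  obtain ⟨-, f, hf, hann⟩ := h
  obtain ⟨N, hN⟩ := Filter.eventually_atTop.1 (eventually_mul_segIdem hp f)
  have h1 : ∀ n, N ≤ n → f * segIdem K p n = segIdem K p n := fun n hn => by
    rw [hN n hn, hf, approxSection_self hp]
  -- Both `segIdem K p n` and `f` fix `p`, so `f` kills their difference from the right.
  have h2 : ∀ n, segIdem K p n * f = f * f := fun n => by
    rw [← sub_eq_zero, ← sub_mul]
    exact hann _ (by rw [sub_act, act_segIdem hp, hf, sub_self])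
  refine ⟨N, hp.isLinePoint fun n hn => not_isBifurcation_of_segIdem (K := K) ?_⟩
  -- With `uₙ = segIdem K p n`: `uₙ₊₁ uₙ = uₙ₊₁ f uₙ = f f uₙ = uₙ`.
  rw [← h1 n hn, ← mul_assoc, h2, mul_assoc, h1 n hn, h1 n hn]

end ChenModule

theorem mainTheorem6 (K : Type k) [Field K] {V : Type v} {E : Type e} (G : DirectedGraph V E)
    (p : G.InfinitePath) (hp : p.IsIrrational) :
    List.TFAE [
      NonUnitalModule.IsFinitelyPresented (LeavittPathAlgebra K G) (ChenModule K p),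
      NonUnitalModule.IsProjective (LeavittPathAlgebra K G) (ChenModule K p),
      ∃ n : ℕ, G.IsLinePoint (p.vertex n)] := by
  have hq := ChenModule.exists_act_self (K := K) hp
  tfae_have 1 → 3 := fun h => ChenModule.exists_isLinePoint (K := K) hp
    (h.isSplitGenerator LeavittPathAlgebra.isUnitary hq _ (ChenModule.act_segIdem hp)
      (ChenModule.eventually_mul_segIdem_eq_zero hp))
  tfae_have 2 → 3 := fun h => ChenModule.exists_isLinePoint (K := K) hp
    (h.isSplitGenerator LeavittPathAlgebra.isUnitary hq)
  tfae_have 3 → 1 := fun ⟨_, h⟩ =>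
    (ChenModule.isSplitGenerator_of_isLinePoint hp h).isFinitelyPresented
  tfae_have 3 → 2 := fun ⟨_, h⟩ => (ChenModule.isSplitGenerator_of_isLinePoint hp h).isProjective
  tfae_finish
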